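/- Let $(\Omega,\mathcal F)$ be a measurable space, $\mathfrak P(\Omega)$ the set of its probability measures, $\emptyset\ne\mathcal P\subset\mathfrak P(\Omega)$, and $c(A)=\sup_{P\in\mathcal P}P(A)$ for $A\in\mathcal F$. An event $A$ is called $\mathcal P$-polar if $c(A)=0$. For sets $\mathcal R,\mathcal S$ of probability measures, $\mathcal R\ll\mathcal S$ means that every event which is null under all elements of $\mathcal S$ is null under all elements of $\mathcal R$; put $\mathfrak P_c(\Omega)=\{Q\in\mathfrak P(\Omega) : \{Q\}\ll\mathcal P\}$. Let $L^0_c$ be the space of real random variables modulo equality outside a $\mathcal P$-polar event, with the order $[f]\preccurlyeq[g]$ iff $\{f>g\}$ is $\mathcal P$-polar, let $L^0_{c+}=\{X\in L^0_c : 0\preccurlyeq X\}$, and let $L^\infty_{c+}$ be the set of $X\in L^0_{c+}$ with $X\preccurlyeq m$ for some constant $m>0$. For $Q\in\mathfrak P_c(\Omega)$ let $j_Q:L^0_c\to L^0_Q$, $[f]_c\mapsto[f]_Q$, where $L^0_Q$ is the space of random variables modulo $Q$-a.s. equality. A set $\mathcal D\subset L^0_{c+}$ is *solid* if $X\in\mathcal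 D$, $Y\in L^0_{c+}$ and $Y\preccurlyeq X$ imply $Y\in\mathcal D$. It is *sequentially order closed* if $X\in\mathcal D$ whenever $X\in L^0_c$ and there are $X_n\in\mathcal D$ and a decreasing sequence $(Y_n)_{n\in\mathbb N}$ in $L^0_c$ with greatest lower bound $0$ and $|X_n-X|\preccurlyeq Y_n$ for all $n\in\mathbb N$. It is *$\mathcal P$-sensitive* if $\mathcal D=\bigcap_{Q\in\mathfrak P_c(\Omega)}j_Q^{-1}(j_Q(\mathcal D))$. A non-empty set $\mathcal Q\subset\mathfrak P_c(\Omega)$ is a *reduction set for $\mathcal D$ in $L^0_{c+}$* if $$\mathcal D=L^0_{c+}\cap\bigcap_{Q\in\mathcal Q}j_Q^{-1}(j_Q(\mathcal D)),$$ and a *reduction set for $\mathcal D$ in $L^0_c$* if this holds without the intersection with $L^0_{c+}$. **Theorem.** Let $\mathcal C\subset L^0_{c+}$ and $\mathcal Q\subset\mathfrak P_c(\Omega)$ be non-empty, and let $$\mathcal C^\circ_{\mathcal Q}=\{(Q,Z)\in\mathcal Q\times L^\infty_{c+} : E_Q[ZX]\le 1\ \text{for all } X\in\mathcal C\},$$ $$\mathcal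 C^{\circ\circ}_{\mathcal Q}=\{X\in L^0_{c+} : E_Q[ZX]\le 1\ \text{for all }(Q,Z)\in\mathcal C^\circ_{\mathcal Q}\}.$$ 1. The set $\mathcal C^{\circ\circ}_{\mathcal Q}$ is convex, solid, sequentially order closed, and $\mathcal P$-sensitive with reduction set $\mathcal Q$ in $L^0_{c+}$, and $\mathcal C\subset\mathcal C^{\circ\circ}_{\mathcal Q}$. It is the smallest such set: every $\mathcal D\subset L^0_{c+}$ with $\mathcal C\subset\mathcal D$ which is convex, solid, sequentially order closed, and $\mathcal P$-sensitive with reduction set $\mathcal Q$ in $L^0_{c+}$ satisfies $\mathcal C^{\circ\circ}_{\mathcal Q}\subset\mathcal D$. In particular, $\mathcal C=\mathcal C^{\circ\circ}_{\mathcal Q}$ if and only if $\mathcal C$ is convex, solid, sequentially order closed, and $\mathcal P$-sensitive with reduction set $\mathcal Q$ in $L^0_{c+}$. 2. If $\mathcal P\ll\mathcal Q$, then all assertions of part 1 also hold with reduction sets in $L^0_c$ in place of reduction sets in $L^0_{c+}$. -/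

import Mathlib

open MeasureTheory
open scoped ENNReal

namespace RobustBipolar

variable {Ω : Type*} [MeasurableSpace Ω]

/-- The upper probability `c(A) = sup_{P ∈ 𝓟} P(A)`. -/
noncomputable def upperProb (𝓟 : Set (ProbabilityMeasure Ω)) (A : Set Ω) : ℝ≥0∞ :=
  ⨆ P ∈ 𝓟, (P : Measure Ω) A

/-- `𝓠 ≪ 𝓟`, i.e. `𝓟` dominates `𝓠`: every event which is null under all `P ∈ 𝓟` is null under
all `Q ∈ 𝓠`. -/
def DominatedBy (𝓠 𝓟 : Set (ProbabilityMeasure Ω)) : Prop :=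
  ∀ N : Set Ω, MeasurableSet N → upperProb 𝓟 N = 0 → upperProb 𝓠 N = 0

/-- The set `𝔓_c(Ω)` of probability measures `Q` with `{Q} ≪ 𝓟`. -/
def Pc (𝓟 : Set (ProbabilityMeasure Ω)) : Set (ProbabilityMeasure Ω) :=
  {Q | DominatedBy {Q} 𝓟}

/-- The sum of all measures in `𝓟`. It only serves to encode `𝓟`-quasi-sure statements: an event is
null for it if and only if it is `𝓟`-polar, see `qsMeasure_eq_zero_iff`. -/
noncomputable def qsMeasure (𝓟 : Set (ProbabilityMeasure Ω)) : Measure Ω :=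
  Measure.sum fun P : 𝓟 => ((P : ProbabilityMeasure Ω) : Measure Ω)

/-- The space `L⁰_c` of real random variables modulo `𝓟`-quasi-sure equality, with its quasi-sure
order, vector space, lattice and multiplicative structure. Every element is the class of a
measurable function (`exists_measurable_rep`), two measurable functions have the same class iff they
differ on a `𝓟`-polar event (`mk_eq_mk_iff`), and `[f] ≤ [g]` iff `{f > g}` is `𝓟`-polar
(`mk_le_mk_iff`). -/
abbrev L0 (𝓟 : Set (ProbabilityMeasure Ω)) : Type _ := Ω →ₘ[qsMeasure 𝓟] ℝ

theorem upperProb_eq_zero_iff (𝓟 : Set (ProbabilityMeasure Ω)) (A : Set Ω) :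
    upperProb 𝓟 A = 0 ↔ ∀ P ∈ 𝓟, (P : Measure Ω) A = 0 := by
  simp [upperProb]

theorem qsMeasure_eq_zero_iff (𝓟 : Set (ProbabilityMeasure Ω)) {A : Set Ω} (hA : MeasurableSet A) :
    qsMeasure 𝓟 A = 0 ↔ upperProb 𝓟 A = 0 := by
  rw [upperProb_eq_zero_iff, qsMeasure, Measure.sum_apply_eq_zero' hA]
  simp

theorem exists_measurable_rep {𝓟 : Set (ProbabilityMeasure Ω)} (X : L0 𝓟) :
    ∃ (f : Ω → ℝ) (hf : Measurable f), X = AEEqFun.mk f hf.aestronglyMeasurable :=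
  ⟨X, X.measurable, (AEEqFun.mk_coeFn X).symm⟩

theorem mk_eq_mk_iff {𝓟 : Set (ProbabilityMeasure Ω)} {f g : Ω → ℝ} (hf : Measurable f)
    (hg : Measurable g) :
    (AEEqFun.mk f hf.aestronglyMeasurable : L0 𝓟) = AEEqFun.mk g hg.aestronglyMeasurable ↔
      upperProb 𝓟 {ω | f ω ≠ g ω} = 0 := by
  rw [AEEqFun.mk_eq_mk]
  exact qsMeasure_eq_zero_iff 𝓟 (measurableSet_eq_fun hf hg).compl

theorem mk_le_mk_iff {𝓟 : Set (ProbabilityMeasure Ω)} {f g : Ω → ℝ} (hf : Measurable f)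
    (hg : Measurable g) :
    (AEEqFun.mk f hf.aestronglyMeasurable : L0 𝓟) ≤ AEEqFun.mk g hg.aestronglyMeasurable ↔
      upperProb 𝓟 {ω | g ω < f ω} = 0 := by
  rw [AEEqFun.mk_le_mk, ← qsMeasure_eq_zero_iff 𝓟 (measurableSet_lt hg hf),
    Filter.EventuallyLE, ae_iff]
  simp only [not_le]

theorem absolutelyContinuous_of_mem_Pc {𝓟 : Set (ProbabilityMeasure Ω)} {Q : ProbabilityMeasure Ω}
    (hQ : Q ∈ Pc 𝓟) : (Q : Measure Ω) ≪ qsMeasure 𝓟 :=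
  Measure.AbsolutelyContinuous.mk fun N hN h =>
    (upperProb_eq_zero_iff {Q} N).1 (hQ N hN ((qsMeasure_eq_zero_iff 𝓟 hN).1 h)) Q rfl

/-- The positive cone `L⁰_{c+}`. -/
def L0plus (𝓟 : Set (ProbabilityMeasure Ω)) : Set (L0 𝓟) := {X | 0 ≤ X}

/-- The positive cone `L^∞_{c+}` of the space of quasi-surely bounded random variables. -/
def Linftyplus (𝓟 : Set (ProbabilityMeasure Ω)) : Set (L0 𝓟) :=
  {X | 0 ≤ X ∧ ∃ m : ℝ, 0 < m ∧ |X| ≤ AEEqFun.const Ω m}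

/-- The map `j_Q : L⁰_c → L⁰_Q`, `[f]_c ↦ [f]_Q`. -/
noncomputable def j {𝓟 : Set (ProbabilityMeasure Ω)} (Q : Pc 𝓟) (X : L0 𝓟) :
    Ω →ₘ[(Q.1 : Measure Ω)] ℝ :=
  AEEqFun.mk X (X.aestronglyMeasurable.mono_ac (absolutelyContinuous_of_mem_Pc Q.2))

/-- The expectation `E_Q[X] ∈ [0, ∞]` of a non-negative `X`. -/
noncomputable def expect {𝓟 : Set (ProbabilityMeasure Ω)} (Q : Pc 𝓟) (X : L0 𝓟) : ℝ≥0∞ :=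
  ∫⁻ ω, ENNReal.ofReal (X ω) ∂(Q.1 : Measure Ω)

/-- The polar `C°_𝓠 = {(Q, Z) ∈ 𝓠 × L^∞_{c+} | ∀ X ∈ C, E_Q[Z X] ≤ 1}`. -/
def polar {𝓟 : Set (ProbabilityMeasure Ω)} (𝓠 : Set (Pc 𝓟)) (C : Set (L0 𝓟)) :
    Set (Pc 𝓟 × L0 𝓟) :=
  {p | p ∈ 𝓠 ×ˢ Linftyplus 𝓟 ∧ ∀ X ∈ C, expect p.1 (p.2 * X) ≤ 1}

/-- The bipolar `C°°_𝓠 = {X ∈ L⁰_{c+} | ∀ (Q, Z) ∈ C°_𝓠, E_Q[Z X] ≤ 1}`. -/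
def bipolar {𝓟 : Set (ProbabilityMeasure Ω)} (𝓠 : Set (Pc 𝓟)) (C : Set (L0 𝓟)) : Set (L0 𝓟) :=
  {X | X ∈ L0plus 𝓟 ∧ ∀ p ∈ polar 𝓠 C, expect p.1 (p.2 * X) ≤ 1}

/-- Solidness in `L⁰_c` or in `L⁰_{c+}`. -/
def IsSolid {𝓟 : Set (ProbabilityMeasure Ω)} (C : Set (L0 𝓟)) : Prop :=
  (∀ X ∈ C, ∀ Y : L0 𝓟, |Y| ≤ |X| → Y ∈ C) ∨
    (C ⊆ L0plus 𝓟 ∧ ∀ X ∈ C, ∀ Y ∈ L0plus 𝓟, Y ≤ X → Y ∈ C)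

/-- Order convergence of the sequence `X` to `X₀` with respect to the quasi-sure order. -/
def OrderConverges {𝓟 : Set (ProbabilityMeasure Ω)} (X : ℕ → L0 𝓟) (X₀ : L0 𝓟) : Prop :=
  ∃ Y : ℕ → L0 𝓟, Antitone Y ∧ IsGLB (Set.range Y) 0 ∧ ∀ n, |X n - X₀| ≤ Y n

/-- Sequential order closedness. -/
def IsSeqOrderClosed {𝓟 : Set (ProbabilityMeasure Ω)} (C : Set (L0 𝓟)) : Prop :=
  ∀ (X : ℕ → L0 𝓟) (X₀ : L0 𝓟), (∀ n, X n ∈ C) → OrderConverges X X₀ → X₀ ∈ C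

/-- `𝓠` is a reduction set for `C` in `𝓧`: it is non-empty and
`C = 𝓧 ∩ ⋂_{Q ∈ 𝓠} j_Q⁻¹(j_Q(C))`. For `𝓧 = Set.univ` this is a reduction set for `C`
without reference to an ambient set. -/
def IsReductionSetIn {𝓟 : Set (ProbabilityMeasure Ω)} (𝓧 : Set (L0 𝓟)) (𝓠 : Set (Pc 𝓟))
    (C : Set (L0 𝓟)) : Prop :=
  𝓠.Nonempty ∧ C = 𝓧 ∩ ⋂ Q ∈ 𝓠, j Q ⁻¹' (j Q '' C)

/-- `𝓟`-sensitivity: `C = ⋂_{Q ∈ 𝔓_c(Ω)} j_Q⁻¹(j_Q(C))`. -/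
def IsSensitive {𝓟 : Set (ProbabilityMeasure Ω)} (C : Set (L0 𝓟)) : Prop :=
  C = ⋂ Q : Pc 𝓟, j Q ⁻¹' (j Q '' C)

/-- `C` is convex, solid, sequentially order closed, and `𝓟`-sensitive with reduction set `𝓠`
(in `𝓧`). -/
structure IsBipolarClosedIn {𝓟 : Set (ProbabilityMeasure Ω)} (𝓧 : Set (L0 𝓟)) (𝓠 : Set (Pc 𝓟))
    (C : Set (L0 𝓟)) : Prop where
  convex : Convex ℝ C
  solid : IsSolid C
  seqOrderClosed : IsSeqOrderClosed C
  sensitive : IsSensitive C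
  reductionSet : IsReductionSetIn 𝓧 𝓠 C

end RobustBipolar

open RobustBipolar

/-!
The bipolar `C°°_𝓠` is cut out by the inequalities `E_Q[Z X] ≤ 1`, and each of its properties is
inherited from them: convexity and solidness from linearity and monotonicity of the integral,
sequential order closedness from Fatou's lemma, since order convergence implies quasi-sure
convergence (`OrderConverges.ae_tendsto`), and sensitivity together with the reduction set because
`E_Q[Z X]` depends on `X` only through `j Q X`. What remains is positivity of `X`, which is visible
under a family of measures as soon as it dominates `𝓟` (`nonneg_of_dominatedBy`).

For minimality, let `D ⊇ C` have these properties and let `X ∈ C°°_𝓠`. As `𝓠` is a reduction set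
for `D`, it suffices to show `j Q X ∈ j Q '' D` for each `Q ∈ 𝓠`, a question about one probability
measure. The set `j Q '' D` is convex, solid and closed under `Q`-almost sure limits
(`exists_mem_ae_eq_of_ae_tendsto`): multiplication by the indicator of the set of convergence keeps
a sequence in `D` by solidness and makes it converge everywhere, hence in order
(`orderConverges_mk`). The square integrable part of `j Q '' D` is therefore a closed convex set in
the Hilbert space `L²(Q)`. If it missed a truncation `X ∧ n`, a nonnegative bounded `Z` would
separate the two (`exists_bounded_separating`), with `E_Q[Z Y] ≤ 1` for all `Y ∈ D` and
`1 < E_Q[Z (X ∧ n)] ≤ E_Q[Z X]`. This contradicts `X ∈ C°°_𝓠`, because `(Q, Z)` lies in the polar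
of `D`, hence in that of `C`. So all truncations of `X`, and with them `X`, belong to `j Q '' D`.
-/

namespace RobustBipolar

open Filter (Tendsto atTop liminf liminf_le_liminf liminf_const eventually_atTop
  eventually_ge_atTop)
open scoped Topology

/-! ### Separation by bounded functions in `L²` -/

theorem tendsto_min_natCast (x : ℝ) : Tendsto (fun n : ℕ => min x n) atTop (𝓝 x) := by
  refine tendsto_const_nhds.congr' ?_
  obtain ⟨k, hk⟩ := exists_nat_ge x
  filter_upwards [eventually_ge_atTop k] with n hn
  rw [min_eq_left (hk.trans (by exact_mod_cast hn))]

theorem ofReal_integral_le_lintegral_ofReal {Ω : Type*} [MeasurableSpace Ω] {ν : Measure Ω}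
    {h : Ω → ℝ} (hh : Integrable h ν) :
    ENNReal.ofReal (∫ ω, h ω ∂ν) ≤ ∫⁻ ω, ENNReal.ofReal (h ω) ∂ν := by
  refine ENNReal.ofReal_le_of_le_toReal ?_
  rw [integral_eq_lintegral_pos_part_sub_lintegral_neg_part hh]
  exact sub_le_self _ ENNReal.toReal_nonneg

/-- A nonnegative `x` outside a closed, convex and solid set of nonnegative elements of `L²(ν)` is
separated from it by a nonnegative bounded function. A separating functional exists by the
Hahn-Banach theorem and is represented by some `z ∈ L²(ν)`; solidity permits replacing `z` by its
positive part, and truncating at a high level keeps the strict inequality at `x`. -/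
theorem exists_bounded_separating {Ω : Type*} [MeasurableSpace Ω] {ν : Measure Ω}
    {S : Set (Lp ℝ 2 ν)} (hconv : Convex ℝ S) (hcl : IsClosed S) (h0 : 0 ∈ S)
    (hpos : ∀ f ∈ S, 0 ≤ f) (hsolid : ∀ f ∈ S, ∀ g, 0 ≤ g → g ≤ f → g ∈ S)
    {x : Lp ℝ 2 ν} (hx0 : 0 ≤ x) (hx : x ∉ S) :
    ∃ Z : Ω → ℝ, Measurable Z ∧ (∀ ω, 0 ≤ Z ω) ∧ (∃ m, 0 < m ∧ ∀ ω, Z ω ≤ m) ∧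
      (∀ f ∈ S, ∫⁻ ω, ENNReal.ofReal (Z ω * f ω) ∂ν ≤ 1) ∧
      1 < ∫⁻ ω, ENNReal.ofReal (Z ω * x ω) ∂ν := by
  obtain ⟨φ, u, hu, hux⟩ := geometric_hahn_banach_closed_point hconv hcl hx
  have hu0 : 0 < u := by simpa using hu 0 h0
  set z := (InnerProductSpace.toDual ℝ (Lp ℝ 2 ν)).symm φ with hz
  have hφ (f : Lp ℝ 2 ν) : φ f = ∫ ω, z ω * f ω ∂ν := by
    rw [← InnerProductSpace.toDual_symm_apply (𝕜 := ℝ), L2.inner_def]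
    exact integral_congr_ae (.of_forall fun ω => by simp [hz, mul_comm])
  have hint (f : Lp ℝ 2 ν) : Integrable (fun ω => z ω * f ω) ν :=
    (L2.integrable_inner (𝕜 := ℝ) z f).congr (.of_forall fun ω => by simp [mul_comm])
  have hzm : Measurable z := (Lp.stronglyMeasurable z).measurable
  have hxm : Measurable x := (Lp.stronglyMeasurable x).measurable
  have hx0' : ∀ᵐ ω ∂ν, 0 ≤ x ω := (Lp.coeFn_nonneg x).2 hx0
  -- Solidity allows testing `z` against `f` restricted to `{z > 0}`, i.e. `z⁺` against `f`.
  have hS : ∀ f ∈ S, ∫⁻ ω, ENNReal.ofReal (max (z ω) 0 * f ω) ∂ν ≤ ENNReal.ofReal u := by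
    intro f hf
    have hf0 : ∀ᵐ ω ∂ν, 0 ≤ f ω := (Lp.coeFn_nonneg f).2 (hpos f hf)
    have hmem := (Lp.memLp f).indicator
      (measurableSet_lt measurable_const hzm : MeasurableSet {ω | 0 < z ω})
    set g := hmem.toLp with hg
    have hgf : g =ᵐ[ν] {ω | 0 < z ω}.indicator f := hmem.coeFn_toLp
    have hgS : g ∈ S := by
      refine hsolid f hf g ((Lp.coeFn_nonneg g).1 ?_) ((Lp.coeFn_le g f).1 ?_)
      · filter_upwards [hgf, hf0] with ω h1 h2
        rw [h1]; exact Set.indicator_apply_nonneg fun _ => h2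
      · filter_upwards [hgf, hf0] with ω h1 h2
        rw [h1]; exact Set.indicator_apply_le' (fun _ => le_rfl) fun _ => h2
    have hae : ∀ᵐ ω ∂ν, max (z ω) 0 * f ω = z ω * g ω := by
      filter_upwards [hgf] with ω h1
      rw [h1]
      by_cases h : 0 < z ω
      · rw [Set.indicator_of_mem (by exact h), max_eq_left h.le]
      · rw [Set.indicator_of_notMem (by exact h), max_eq_right (not_lt.1 h)]; simp
    rw [lintegral_congr_ae (hae.mono fun ω h => congrArg ENNReal.ofReal h),
      ← ofReal_integral_eq_lintegral_ofReal (hint g), ← hφ]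
    · exact ENNReal.ofReal_le_ofReal (hu g hgS).le
    · filter_upwards [hae, hf0] with ω h1 h2
      rw [← h1]; exact mul_nonneg (le_max_right _ _) h2
  have hX : ENNReal.ofReal u < ∫⁻ ω, ENNReal.ofReal (max (z ω) 0 * x ω) ∂ν := by
    calc ENNReal.ofReal u < ENNReal.ofReal (φ x) :=
          (ENNReal.ofReal_lt_ofReal_iff (hu0.trans hux)).2 hux
      _ ≤ ∫⁻ ω, ENNReal.ofReal (z ω * x ω) ∂ν := by
          rw [hφ]; exact ofReal_integral_le_lintegral_ofReal (hint x)
      _ ≤ _ := lintegral_mono_ae <| hx0'.mono fun ω h =>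
          ENNReal.ofReal_le_ofReal (mul_le_mul_of_nonneg_right (le_max_left _ _) h)
  have hlim : Tendsto (fun n : ℕ => ∫⁻ ω, ENNReal.ofReal (min (max (z ω) 0) n * x ω) ∂ν) atTop
      (𝓝 (∫⁻ ω, ENNReal.ofReal (max (z ω) 0 * x ω) ∂ν)) := by
    refine lintegral_tendsto_of_tendsto_of_monotone (fun n => by fun_prop) ?_ ?_
    · filter_upwards [hx0'] with ω h n m hnm
      have : (n : ℝ) ≤ m := by exact_mod_cast hnm
      exact ENNReal.ofReal_le_ofReal
        (mul_le_mul_of_nonneg_right (min_le_min_left _ this) h)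
    · filter_upwards with ω
      exact ENNReal.tendsto_ofReal ((tendsto_min_natCast _).mul_const _)
  obtain ⟨n, hn, hn1⟩ :=
    ((hlim.eventually (lt_mem_nhds hX)).and (eventually_ge_atTop 1)).exists
  have hn0 : (0 : ℝ) < n := by exact_mod_cast hn1
  -- Dividing by `u` normalizes the bound on `S` to `1`.
  have hscale (f : Ω → ℝ) : ∫⁻ ω, ENNReal.ofReal (u⁻¹ * min (max (z ω) 0) n * f ω) ∂ν =
      (ENNReal.ofReal u)⁻¹ * ∫⁻ ω, ENNReal.ofReal (min (max (z ω) 0) n * f ω) ∂ν := by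
    rw [← ENNReal.ofReal_inv_of_pos hu0, ← lintegral_const_mul' _ _ ENNReal.ofReal_ne_top]
    simp_rw [← ENNReal.ofReal_mul (inv_nonneg.2 hu0.le), mul_assoc]
  have hune : ENNReal.ofReal u ≠ 0 := by simpa using hu0
  refine ⟨fun ω => u⁻¹ * min (max (z ω) 0) n, by fun_prop, fun ω => by positivity,
    ⟨u⁻¹ * n, by positivity, fun ω =>
      mul_le_mul_of_nonneg_left (min_le_right _ _) (inv_nonneg.2 hu0.le)⟩, fun f hf => ?_, ?_⟩
  · rw [hscale, mul_comm, ← div_eq_mul_inv]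
    refine ENNReal.div_le_of_le_mul ?_
    rw [one_mul]
    refine le_trans (lintegral_mono_ae ?_) (hS f hf)
    filter_upwards [(Lp.coeFn_nonneg f).2 (hpos f hf)] with ω h
    exact ENNReal.ofReal_le_ofReal (mul_le_mul_of_nonneg_right (min_le_left _ _) h)
  · rw [hscale, mul_comm, ← div_eq_mul_inv, ENNReal.lt_div_iff_mul_lt (.inl hune)
      (.inl ENNReal.ofReal_ne_top), one_mul]
    exact hn

/-! ### Quasi-sure statements and expectations -/

variable {Ω : Type*} [MeasurableSpace Ω] {𝓟 : Set (ProbabilityMeasure Ω)}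

theorem ae_of_ae_qsMeasure (Q : Pc 𝓟) {p : Ω → Prop} (h : ∀ᵐ ω ∂qsMeasure 𝓟, p ω) :
    ∀ᵐ ω ∂(Q.1 : Measure Ω), p ω :=
  (absolutelyContinuous_of_mem_Pc Q.2).ae_le h

theorem j_eq_iff {Q : Pc 𝓟} {X Y : L0 𝓟} : j Q X = j Q Y ↔ X =ᵐ[(Q.1 : Measure Ω)] Y :=
  AEEqFun.mk_eq_mk

theorem ae_nonneg {X : L0 𝓟} (hX : 0 ≤ X) : ∀ᵐ ω ∂qsMeasure 𝓟, 0 ≤ X ω := by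
  filter_upwards [AEEqFun.coeFn_le.2 hX, (AEEqFun.coeFn_const Ω (0 : ℝ) : _ =ᵐ[qsMeasure 𝓟] _)]
    with ω h h'
  exact h'.ge.trans h

theorem nonneg_of_ae {X : L0 𝓟} (hX : ∀ᵐ ω ∂qsMeasure 𝓟, 0 ≤ X ω) : 0 ≤ X := by
  refine AEEqFun.coeFn_le.1 ?_
  filter_upwards [hX, (AEEqFun.coeFn_const Ω (0 : ℝ) : _ =ᵐ[qsMeasure 𝓟] _)] with ω h h'
  exact h'.le.trans h

/-- Nonnegativity under all measures of a family dominating `𝓟` is quasi-sure nonnegativity. -/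
theorem nonneg_of_dominatedBy {𝓠 : Set (Pc 𝓟)} (hdom : DominatedBy 𝓟 (Subtype.val '' 𝓠))
    {X : L0 𝓟} (hX : ∀ Q ∈ 𝓠, ∀ᵐ ω ∂(Q.1 : Measure Ω), 0 ≤ X ω) : 0 ≤ X := by
  have hm : MeasurableSet {ω | ¬ 0 ≤ X ω} :=
    (measurableSet_le measurable_const X.measurable).compl
  refine nonneg_of_ae (ae_iff.2 ?_)
  rw [qsMeasure_eq_zero_iff 𝓟 hm]
  refine hdom _ hm ((upperProb_eq_zero_iff _ _).2 ?_)
  rintro _ ⟨Q, hQ, rfl⟩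
  exact ae_iff.1 (hX Q hQ)

theorem dominatedBy_Pc (𝓟 : Set (ProbabilityMeasure Ω)) :
    DominatedBy 𝓟 (Subtype.val '' (Set.univ : Set (Pc 𝓟))) := by
  intro N _ h
  rw [upperProb_eq_zero_iff] at h ⊢
  intro P hP
  refine h P ⟨⟨P, fun M _ hM => ?_⟩, trivial, rfl⟩
  rw [upperProb_eq_zero_iff] at hM ⊢
  rintro _ rfl
  exact hM _ hP

theorem expect_mul (Q : Pc 𝓟) (Z X : L0 𝓟) :
    expect Q (Z * X) = ∫⁻ ω, ENNReal.ofReal (Z ω * X ω) ∂(Q.1 : Measure Ω) := by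
  refine lintegral_congr_ae ?_
  filter_upwards [ae_of_ae_qsMeasure Q (AEEqFun.coeFn_mul Z X)] with ω h
  rw [h, Pi.mul_apply]

theorem expect_mul_congr {Q : Pc 𝓟} {X Y : L0 𝓟} (h : j Q X = j Q Y) (Z : L0 𝓟) :
    expect Q (Z * X) = expect Q (Z * Y) := by
  rw [expect_mul, expect_mul]
  refine lintegral_congr_ae ?_
  filter_upwards [j_eq_iff.1 h] with ω h
  rw [h]

theorem expect_mul_mono {Q : Pc 𝓟} {X Y Z : L0 𝓟} (hZ : 0 ≤ Z) (h : X ≤ Y) :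
    expect Q (Z * X) ≤ expect Q (Z * Y) := by
  rw [expect_mul, expect_mul]
  refine lintegral_mono_ae ?_
  filter_upwards [ae_of_ae_qsMeasure Q (AEEqFun.coeFn_le.2 h),
    ae_of_ae_qsMeasure Q (ae_nonneg hZ)] with ω h h'
  exact ENNReal.ofReal_le_ofReal (mul_le_mul_of_nonneg_left h h')

theorem expect_mul_convexComb {Q : Pc 𝓟} {X Y Z : L0 𝓟} (hZ : 0 ≤ Z) (hX : 0 ≤ X) (hY : 0 ≤ Y)
    {a b : ℝ} (ha : 0 ≤ a) (hb : 0 ≤ b) :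
    expect Q (Z * (a • X + b • Y)) =
      ENNReal.ofReal a * expect Q (Z * X) + ENNReal.ofReal b * expect Q (Z * Y) := by
  simp only [expect_mul]
  have mX : Measurable X := X.measurable
  have mY : Measurable Y := Y.measurable
  have mZ : Measurable Z := Z.measurable
  rw [← lintegral_const_mul _ (by fun_prop), ← lintegral_const_mul _ (by fun_prop),
    ← lintegral_add_left (by fun_prop)]
  refine lintegral_congr_ae ?_
  filter_upwards [ae_of_ae_qsMeasure Q (AEEqFun.coeFn_add (a • X) (b • Y)),
    ae_of_ae_qsMeasure Q (AEEqFun.coeFn_smul a X), ae_of_ae_qsMeasure Q (AEEqFun.coeFn_smul b Y),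
    ae_of_ae_qsMeasure Q (ae_nonneg hX), ae_of_ae_qsMeasure Q (ae_nonneg hY),
    ae_of_ae_qsMeasure Q (ae_nonneg hZ)] with ω h1 h2 h3 h4 h5 h6
  rw [h1, Pi.add_apply, h2, h3, Pi.smul_apply, Pi.smul_apply, ← ENNReal.ofReal_mul ha,
    ← ENNReal.ofReal_mul hb, ← ENNReal.ofReal_add (by positivity) (by positivity)]
  congr 1
  simp only [smul_eq_mul]
  ring

/-! ### Order convergence and pointwise convergence -/

/-- Fatou's lemma, for integrals tested against a fixed `Z`. -/
theorem lintegral_mul_le_of_tendsto {ν : Measure Ω} {Z : Ω → ℝ} (hZ : Measurable Z)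
    {f : ℕ → Ω → ℝ} (hf : ∀ n, Measurable (f n)) {g : Ω → ℝ}
    (h : ∀ᵐ ω ∂ν, Tendsto (fun n => f n ω) atTop (𝓝 (g ω))) {c : ℝ≥0∞}
    (hc : ∀ n, ∫⁻ ω, ENNReal.ofReal (Z ω * f n ω) ∂ν ≤ c) :
    ∫⁻ ω, ENNReal.ofReal (Z ω * g ω) ∂ν ≤ c := by
  calc ∫⁻ ω, ENNReal.ofReal (Z ω * g ω) ∂ν
      = ∫⁻ ω, liminf (fun n => ENNReal.ofReal (Z ω * f n ω)) atTop ∂ν := by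
        refine lintegral_congr_ae (h.mono fun ω hω => ?_)
        exact ((ENNReal.tendsto_ofReal (hω.const_mul (Z ω))).liminf_eq).symm
    _ ≤ liminf (fun n => ∫⁻ ω, ENNReal.ofReal (Z ω * f n ω) ∂ν) atTop :=
        lintegral_liminf_le fun n => by have := hf n; fun_prop
    _ ≤ c := (liminf_le_liminf (.of_forall hc)).trans_eq (liminf_const c)

/-- Order convergence implies quasi-sure pointwise convergence. -/
theorem OrderConverges.ae_tendsto {X : ℕ → L0 𝓟} {X₀ : L0 𝓟} (h : OrderConverges X X₀) :
    ∀ᵐ ω ∂qsMeasure 𝓟, Tendsto (fun n => X n ω) atTop (𝓝 (X₀ ω)) := by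
  obtain ⟨Y, hanti, hglb, hXY⟩ := h
  have hY0 : ∀ᵐ ω ∂qsMeasure 𝓟, ∀ n, 0 ≤ Y n ω :=
    ae_all_iff.2 fun n => ae_nonneg (hglb.1 ⟨n, rfl⟩)
  have hYanti : ∀ᵐ ω ∂qsMeasure 𝓟, ∀ n, Y (n + 1) ω ≤ Y n ω :=
    ae_all_iff.2 fun n => AEEqFun.coeFn_le.2 (hanti n.le_succ)
  have hb : ∀ᵐ ω ∂qsMeasure 𝓟, ∀ n, |X n ω - X₀ ω| ≤ Y n ω := by
    refine ae_all_iff.2 fun n => ?_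
    filter_upwards [AEEqFun.coeFn_le.2 (hXY n), AEEqFun.coeFn_abs (X n - X₀),
      AEEqFun.coeFn_sub (X n) X₀] with ω h1 h2 h3
    rwa [h2, h3] at h1
  -- The pointwise infimum of the `Y n` is a lower bound of the classes, hence nonpositive.
  have hm : Measurable fun ω => ⨅ n, Y n ω := Measurable.iInf fun n => (Y n).measurable
  have hinf : (AEEqFun.mk _ hm.aestronglyMeasurable : L0 𝓟) ≤ 0 := hglb.2 <| by
    rintro _ ⟨n, rfl⟩
    refine AEEqFun.coeFn_le.1 ?_
    filter_upwards [AEEqFun.coeFn_mk _ hm.aestronglyMeasurable, hY0] with ω h1 h2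
    rw [h1]
    exact ciInf_le ⟨0, by rintro _ ⟨k, rfl⟩; exact h2 k⟩ n
  have hinf' : ∀ᵐ ω ∂qsMeasure 𝓟, ⨅ n, Y n ω ≤ 0 := by
    filter_upwards [AEEqFun.coeFn_le.2 hinf, AEEqFun.coeFn_mk _ hm.aestronglyMeasurable,
      (AEEqFun.coeFn_const Ω (0 : ℝ) : _ =ᵐ[qsMeasure 𝓟] _)] with ω h1 h2 h3
    rw [h2] at h1
    exact h1.trans_eq h3
  filter_upwards [hY0, hYanti, hb, hinf'] with ω h0 ha hb hi
  have hlim := tendsto_atTop_ciInf (f := fun n => Y n ω) (antitone_nat_of_succ_le ha)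
    ⟨0, by rintro _ ⟨k, rfl⟩; exact h0 k⟩
  rw [hi.antisymm (le_ciInf h0)] at hlim
  rw [tendsto_iff_dist_tendsto_zero]
  exact squeeze_zero (fun _ => dist_nonneg) hb hlim

/-- Everywhere convergence implies order convergence: the tail suprema of `|f n - g|` are finite,
decrease to `0`, and dominate the differences. -/
theorem orderConverges_mk {f : ℕ → Ω → ℝ} (hf : ∀ n, Measurable (f n)) {g : Ω → ℝ}
    (hg : Measurable g) (h : ∀ ω, Tendsto (fun n => f n ω) atTop (𝓝 (g ω))) :
    OrderConverges (𝓟 := 𝓟) (fun n => AEEqFun.mk (f n) (hf n).aestronglyMeasurable)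
      (AEEqFun.mk g hg.aestronglyMeasurable) := by
  set y : ℕ → Ω → ℝ := fun n ω => ⨆ m, |f (n + m) ω - g ω| with hy
  have hym (n : ℕ) : Measurable (y n) :=
    Measurable.iSup fun m => ((hf (n + m)).sub hg).abs
  have hd (ω : Ω) : Tendsto (fun n => |f n ω - g ω|) atTop (𝓝 0) := by
    simpa [Real.dist_eq] using tendsto_iff_dist_tendsto_zero.1 (h ω)
  have hbdd (ω : Ω) (n : ℕ) : BddAbove (Set.range fun m => |f (n + m) ω - g ω|) :=
    (hd ω).bddAbove_range.mono (by rintro _ ⟨m, rfl⟩; exact ⟨n + m, rfl⟩)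
  have hylim (ω : Ω) : Tendsto (fun n => y n ω) atTop (𝓝 0) := by
    refine tendsto_order.2 ⟨fun a ha => .of_forall fun n => ha.trans_le
      ((abs_nonneg _).trans (le_ciSup (hbdd ω n) 0)), fun a ha => ?_⟩
    obtain ⟨N, hN⟩ := eventually_atTop.1 ((hd ω).eventually (gt_mem_nhds (half_pos ha)))
    filter_upwards [eventually_ge_atTop N] with n hn
    exact (ciSup_le fun m => (hN (n + m) (by omega)).le).trans_lt (half_lt_self ha)
  refine ⟨fun n => AEEqFun.mk (y n) (hym n).aestronglyMeasurable, ?_, ⟨?_, ?_⟩, ?_⟩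
  · refine antitone_nat_of_succ_le fun n => (AEEqFun.mk_le_mk _ _).2 (.of_forall fun ω => ?_)
    refine ciSup_le fun m => ?_
    have := le_ciSup (hbdd ω n) (m + 1)
    rwa [show n + (m + 1) = n + 1 + m by omega] at this
  · rintro _ ⟨n, rfl⟩
    refine nonneg_of_ae ?_
    filter_upwards [AEEqFun.coeFn_mk _ (hym n).aestronglyMeasurable] with ω h
    rw [h]
    exact (abs_nonneg _).trans (le_ciSup (hbdd ω n) 0)
  · intro W hW
    refine AEEqFun.coeFn_le.1 ?_
    have hle : ∀ᵐ ω ∂qsMeasure 𝓟, ∀ n, W ω ≤ y n ω := by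
      refine ae_all_iff.2 fun n => ?_
      filter_upwards [AEEqFun.coeFn_le.2 (hW ⟨n, rfl⟩),
        AEEqFun.coeFn_mk _ (hym n).aestronglyMeasurable] with ω h1 h2
      exact h1.trans_eq h2
    filter_upwards [hle, (AEEqFun.coeFn_const Ω (0 : ℝ) : _ =ᵐ[qsMeasure 𝓟] _)] with ω h1 h2
    exact (ge_of_tendsto' (hylim ω) h1).trans_eq h2.symm
  · intro n
    refine AEEqFun.coeFn_le.1 ?_
    filter_upwards [AEEqFun.coeFn_abs (AEEqFun.mk (f n) (hf n).aestronglyMeasurable -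
        AEEqFun.mk g hg.aestronglyMeasurable : L0 𝓟),
      AEEqFun.coeFn_sub (AEEqFun.mk (f n) (hf n).aestronglyMeasurable : L0 𝓟)
        (AEEqFun.mk g hg.aestronglyMeasurable),
      AEEqFun.coeFn_mk _ (hf n).aestronglyMeasurable, AEEqFun.coeFn_mk _ hg.aestronglyMeasurable,
      AEEqFun.coeFn_mk _ (hym n).aestronglyMeasurable] with ω h1 h2 h3 h4 h5
    rw [h1, h2, Pi.sub_apply, h3, h4, h5]
    exact le_ciSup (hbdd ω n) 0

/-! ### Closedness of the bipolar -/

theorem subset_bipolar (𝓠 : Set (Pc 𝓟)) {C : Set (L0 𝓟)} (hC : C ⊆ L0plus 𝓟) :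
    C ⊆ bipolar 𝓠 C :=
  fun X hX => ⟨hC hX, fun _ hp => hp.2 X hX⟩

theorem convex_bipolar (𝓠 : Set (Pc 𝓟)) (C : Set (L0 𝓟)) : Convex ℝ (bipolar 𝓠 C) := by
  intro X hX Y hY a b ha hb hab
  refine ⟨nonneg_of_ae ?_, fun p hp => ?_⟩
  · filter_upwards [AEEqFun.coeFn_add (a • X) (b • Y), AEEqFun.coeFn_smul a X,
      AEEqFun.coeFn_smul b Y, ae_nonneg hX.1, ae_nonneg hY.1] with ω h1 h2 h3 h4 h5
    rw [h1, Pi.add_apply, h2, h3]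
    exact add_nonneg (mul_nonneg ha h4) (mul_nonneg hb h5)
  · rw [expect_mul_convexComb hp.1.2.1 hX.1 hY.1 ha hb]
    calc _ ≤ ENNReal.ofReal a * 1 + ENNReal.ofReal b * 1 := by
          gcongr
          exacts [hX.2 p hp, hY.2 p hp]
      _ = 1 := by rw [mul_one, mul_one, ← ENNReal.ofReal_add ha hb, hab, ENNReal.ofReal_one]

theorem isSolid_bipolar (𝓠 : Set (Pc 𝓟)) (C : Set (L0 𝓟)) : IsSolid (bipolar 𝓠 C) :=
  .inr ⟨fun _ hX => hX.1, fun _ hX _ hY hYX =>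
    ⟨hY, fun p hp => (expect_mul_mono hp.1.2.1 hYX).trans (hX.2 p hp)⟩⟩

theorem isSeqOrderClosed_bipolar (𝓠 : Set (Pc 𝓟)) (C : Set (L0 𝓟)) :
    IsSeqOrderClosed (bipolar 𝓠 C) := by
  intro X X₀ hX hlim
  have hae := hlim.ae_tendsto
  refine ⟨nonneg_of_ae ?_, fun p hp => ?_⟩
  · filter_upwards [hae, ae_all_iff.2 fun n => ae_nonneg (hX n).1] with ω h h'
    exact ge_of_tendsto' h h'
  · rw [expect_mul]
    refine lintegral_mul_le_of_tendsto p.2.measurable (fun n => (X n).measurable)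
      (ae_of_ae_qsMeasure p.1 hae) fun n => ?_
    rw [← expect_mul]
    exact (hX n).2 p hp

/-- The bipolar only sees `X` through its classes under the measures in `𝓠`. -/
theorem mem_bipolar_of_forall_j_mem {𝓠 : Set (Pc 𝓟)} {C : Set (L0 𝓟)} {X : L0 𝓟} (hX0 : 0 ≤ X)
    (hX : ∀ Q ∈ 𝓠, j Q X ∈ j Q '' bipolar 𝓠 C) : X ∈ bipolar 𝓠 C := by
  refine ⟨hX0, fun p hp => ?_⟩
  obtain ⟨Y, hY, hYX⟩ := hX p.1 hp.1.1
  rw [← expect_mul_congr hYX]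
  exact hY.2 p hp

theorem nonneg_of_forall_j_mem {𝓠 : Set (Pc 𝓟)} (hdom : DominatedBy 𝓟 (Subtype.val '' 𝓠))
    {D : Set (L0 𝓟)} (hD : D ⊆ L0plus 𝓟) {X : L0 𝓟} (hX : ∀ Q ∈ 𝓠, j Q X ∈ j Q '' D) :
    0 ≤ X := by
  refine nonneg_of_dominatedBy hdom fun Q hQ => ?_
  obtain ⟨Y, hY, hYX⟩ := hX Q hQ
  filter_upwards [j_eq_iff.1 hYX, ae_of_ae_qsMeasure Q (ae_nonneg (hD hY))] with ω h1 h2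
  exact h2.trans_eq h1

/-- Each `P ∈ 𝓟` belongs to `𝔓_c(Ω)`, so the condition over all of `𝔓_c(Ω)` also forces
quasi-sure nonnegativity. -/
theorem isSensitive_bipolar (𝓠 : Set (Pc 𝓟)) (C : Set (L0 𝓟)) : IsSensitive (bipolar 𝓠 C) := by
  refine Set.Subset.antisymm (fun X hX => Set.mem_iInter.2 fun Q => ⟨X, hX, rfl⟩) fun X hX => ?_
  have hX := Set.mem_iInter.1 hX
  exact mem_bipolar_of_forall_j_mem
    (nonneg_of_forall_j_mem (dominatedBy_Pc 𝓟) (fun _ h => h.1) fun Q _ => hX Q) fun Q _ => hX Q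

/-- Both ambient sets of interest are covered: the hypothesis `hpos` is trivial for `L⁰_{c+}`, and
for all of `L⁰_c` it holds when `𝓠` dominates `𝓟`. -/
theorem isReductionSetIn_bipolar {𝓧 : Set (L0 𝓟)} {𝓠 : Set (Pc 𝓟)} (h𝓠 : 𝓠.Nonempty)
    (C : Set (L0 𝓟)) (hsub : L0plus 𝓟 ⊆ 𝓧)
    (hpos : ∀ X ∈ 𝓧, (∀ Q ∈ 𝓠, j Q X ∈ j Q '' bipolar 𝓠 C) → 0 ≤ X) :
    IsReductionSetIn 𝓧 𝓠 (bipolar 𝓠 C) := by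
  refine ⟨h𝓠, Set.Subset.antisymm
    (fun X hX => ⟨hsub hX.1, Set.mem_iInter₂.2 fun Q _ => ⟨X, hX, rfl⟩⟩) fun X hX => ?_⟩
  have hj := Set.mem_iInter₂.1 hX.2
  exact mem_bipolar_of_forall_j_mem (hpos X hX.1 hj) hj

theorem isBipolarClosedIn_bipolar {𝓧 : Set (L0 𝓟)} {𝓠 : Set (Pc 𝓟)} (h𝓠 : 𝓠.Nonempty)
    (C : Set (L0 𝓟)) (hsub : L0plus 𝓟 ⊆ 𝓧)
    (hpos : ∀ X ∈ 𝓧, (∀ Q ∈ 𝓠, j Q X ∈ j Q '' bipolar 𝓠 C) → 0 ≤ X) :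
    IsBipolarClosedIn 𝓧 𝓠 (bipolar 𝓠 C) where
  convex := convex_bipolar 𝓠 C
  solid := isSolid_bipolar 𝓠 C
  seqOrderClosed := isSeqOrderClosed_bipolar 𝓠 C
  sensitive := isSensitive_bipolar 𝓠 C
  reductionSet := isReductionSetIn_bipolar h𝓠 C hsub hpos

/-! ### The bipolar theorem under a single measure -/

/-- Either alternative in the definition of solidness yields solidness in `L⁰_{c+}`. -/
theorem IsSolid.mem_of_le {D : Set (L0 𝓟)} (hD : IsSolid D) {X Y : L0 𝓟} (hX : X ∈ D)
    (hY : 0 ≤ Y) (hYX : Y ≤ X) : Y ∈ D := by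
  rcases hD with h | h
  · refine h X hX Y (AEEqFun.coeFn_le.1 ?_)
    filter_upwards [AEEqFun.coeFn_abs X, AEEqFun.coeFn_abs Y, ae_nonneg hY,
      AEEqFun.coeFn_le.2 hYX] with ω h1 h2 h3 h4
    rw [h1, h2, abs_of_nonneg h3]
    exact h4.trans (le_abs_self _)
  · exact h.2 X hX Y hY hYX

/-- For solid and sequentially order closed `D`, the image `j Q '' D` is closed under `Q`-almost
sure limits. Multiplying by the indicator of the set of convergence turns `Q`-almost sure
convergence into everywhere convergence without leaving `D`. -/
theorem exists_mem_ae_eq_of_ae_tendsto {D : Set (L0 𝓟)} (hD0 : D ⊆ L0plus 𝓟) (hsolid : IsSolid D)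
    (hcl : IsSeqOrderClosed D) (Q : Pc 𝓟) {d : ℕ → L0 𝓟} (hd : ∀ n, d n ∈ D) {f : Ω → ℝ}
    (hf : Measurable f)
    (hlim : ∀ᵐ ω ∂(Q.1 : Measure Ω), Tendsto (fun n => d n ω) atTop (𝓝 (f ω))) :
    ∃ e ∈ D, e =ᵐ[(Q.1 : Measure Ω)] f := by
  set A : Set Ω := {ω | Tendsto (fun n => d n ω) atTop (𝓝 (f ω))} with hA
  have hAm : MeasurableSet A := measurableSet_tendsto_fun (fun n => (d n).measurable) hf
  have hm (n : ℕ) : Measurable (A.indicator (d n)) := (d n).measurable.indicator hAm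
  have hfm : Measurable (A.indicator f) := hf.indicator hAm
  refine ⟨AEEqFun.mk _ hfm.aestronglyMeasurable,
    hcl _ _ (fun n => hsolid.mem_of_le (hd n) (nonneg_of_ae ?_) (AEEqFun.coeFn_le.1 ?_))
      (orderConverges_mk hm hfm fun ω => ?_), ?_⟩
  · filter_upwards [AEEqFun.coeFn_mk _ (hm n).aestronglyMeasurable, ae_nonneg (hD0 (hd n))]
      with ω h1 h2
    rw [h1]
    exact Set.indicator_apply_nonneg fun _ => h2
  · filter_upwards [AEEqFun.coeFn_mk _ (hm n).aestronglyMeasurable, ae_nonneg (hD0 (hd n))]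
      with ω h1 h2
    rw [h1]
    exact Set.indicator_apply_le' (fun _ => le_rfl) fun _ => h2
  · by_cases h : ω ∈ A
    · simp only [Set.indicator_of_mem h]
      exact h
    · simp only [Set.indicator_of_notMem h, tendsto_const_nhds]
  · filter_upwards [ae_of_ae_qsMeasure Q (AEEqFun.coeFn_mk _ hfm.aestronglyMeasurable), hlim]
      with ω h1 h2
    rw [h1, Set.indicator_of_mem (by exact h2)]

/-- The square integrable part of `j Q '' D`, as a subset of `L²(Q)`. -/
def l2Part (Q : Pc 𝓟) (D : Set (L0 𝓟)) : Set (Lp ℝ 2 (Q.1 : Measure Ω)) :=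
  {g | ∃ d ∈ D, d =ᵐ[(Q.1 : Measure Ω)] g}

theorem convex_l2Part (Q : Pc 𝓟) {D : Set (L0 𝓟)} (hD : Convex ℝ D) : Convex ℝ (l2Part Q D) := by
  rintro g ⟨d, hd, hdg⟩ g' ⟨d', hd', hdg'⟩ a b ha hb hab
  refine ⟨a • d + b • d', hD hd hd' ha hb hab, ?_⟩
  filter_upwards [hdg, hdg', ae_of_ae_qsMeasure Q (AEEqFun.coeFn_add (a • d) (b • d')),
    ae_of_ae_qsMeasure Q (AEEqFun.coeFn_smul a d), ae_of_ae_qsMeasure Q (AEEqFun.coeFn_smul b d'),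
    Lp.coeFn_add (a • g) (b • g'), Lp.coeFn_smul a g, Lp.coeFn_smul b g']
    with ω h1 h2 h3 h4 h5 h6 h7 h8
  rw [h3, h6, Pi.add_apply, Pi.add_apply, h4, h5, h7, h8]
  simp only [Pi.smul_apply, h1, h2]

theorem isClosed_l2Part (Q : Pc 𝓟) {D : Set (L0 𝓟)} (hD0 : D ⊆ L0plus 𝓟) (hsolid : IsSolid D)
    (hcl : IsSeqOrderClosed D) : IsClosed (l2Part Q D) := by
  refine isSeqClosed_iff_isClosed.1 fun g g₀ hg hlim => ?_
  obtain ⟨ns, -, hns⟩ := (tendstoInMeasure_of_tendsto_Lp hlim).exists_seq_tendsto_ae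
  choose d hd hdg using hg
  refine exists_mem_ae_eq_of_ae_tendsto hD0 hsolid hcl Q (fun n => hd (ns n))
    (Lp.stronglyMeasurable g₀).measurable ?_
  filter_upwards [hns, ae_all_iff.2 hdg] with ω h1 h2
  simpa only [h2] using h1

theorem nonneg_of_mem_l2Part {Q : Pc 𝓟} {D : Set (L0 𝓟)} (hD0 : D ⊆ L0plus 𝓟)
    {g : Lp ℝ 2 (Q.1 : Measure Ω)} (hg : g ∈ l2Part Q D) : 0 ≤ g := by
  obtain ⟨d, hd, hdg⟩ := hg
  refine (Lp.coeFn_nonneg g).1 ?_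
  filter_upwards [hdg, ae_of_ae_qsMeasure Q (ae_nonneg (hD0 hd))] with ω h1 h2
  exact h2.trans_eq h1

/-- Solidness of `D` passes to `l2Part Q D`: if `d ∈ D` represents `g`, then `|g'| ∧ d`, which lies
quasi-surely in `[0, d]`, represents `g'`. -/
theorem mem_l2Part_of_le {Q : Pc 𝓟} {D : Set (L0 𝓟)} (hD0 : D ⊆ L0plus 𝓟) (hsolid : IsSolid D)
    {g g' : Lp ℝ 2 (Q.1 : Measure Ω)} (hg : g ∈ l2Part Q D) (hg' : 0 ≤ g') (hle : g' ≤ g) :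
    g' ∈ l2Part Q D := by
  obtain ⟨d, hd, hdg⟩ := hg
  have hm : Measurable fun ω => min |g' ω| (d ω) :=
    (Lp.stronglyMeasurable g').measurable.abs.min d.measurable
  refine ⟨AEEqFun.mk _ hm.aestronglyMeasurable,
    hsolid.mem_of_le hd (nonneg_of_ae ?_) (AEEqFun.coeFn_le.1 ?_), ?_⟩
  · filter_upwards [AEEqFun.coeFn_mk _ hm.aestronglyMeasurable, ae_nonneg (hD0 hd)] with ω h1 h2
    rw [h1]
    exact le_min (abs_nonneg _) h2
  · filter_upwards [AEEqFun.coeFn_mk _ hm.aestronglyMeasurable] with ω h1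
    rw [h1]
    exact min_le_right _ _
  · filter_upwards [ae_of_ae_qsMeasure Q (AEEqFun.coeFn_mk _ hm.aestronglyMeasurable), hdg,
      (Lp.coeFn_nonneg g').2 hg', (Lp.coeFn_le g' g).2 hle] with ω h1 h2 h3 h4
    rw [h1, abs_of_nonneg h3, min_eq_left (h4.trans_eq h2.symm)]

theorem memLp_min_natCast (Q : Pc 𝓟) {X : L0 𝓟} (hX : 0 ≤ X) (n : ℕ) :
    MemLp (fun ω => min (X ω) n) 2 (Q.1 : Measure Ω) := by
  refine MemLp.of_bound (X.measurable.min measurable_const).aestronglyMeasurable n ?_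
  filter_upwards [ae_of_ae_qsMeasure Q (ae_nonneg hX)] with ω h
  rw [Real.norm_of_nonneg (le_min h n.cast_nonneg)]
  exact min_le_right _ _

/-- The bipolar theorem of Brannath and Schachermayer for a single measure `Q`. The truncations
`X ∧ n` lie in `L²(Q)`. One that is not represented in `D` would be separated from the square
integrable part of `j Q '' D` by a bounded `Z`, against the hypothesis on `X`. Hence all of them are
represented in `D`, and so is their limit `X`. -/
theorem j_mem_image_of_forall_expect_le {D : Set (L0 𝓟)} (hD : D.Nonempty) (hD0 : D ⊆ L0plus 𝓟)
    (hconv : Convex ℝ D) (hsolid : IsSolid D) (hcl : IsSeqOrderClosed D) {Q : Pc 𝓟} {X : L0 𝓟}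
    (hX0 : 0 ≤ X)
    (hX : ∀ Z ∈ Linftyplus 𝓟, (∀ Y ∈ D, expect Q (Z * Y) ≤ 1) → expect Q (Z * X) ≤ 1) :
    j Q X ∈ j Q '' D := by
  suffices htrunc : ∀ n : ℕ, (memLp_min_natCast Q hX0 n).toLp ∈ l2Part Q D by
    choose d hd hdX using htrunc
    obtain ⟨e, he, heX⟩ := exists_mem_ae_eq_of_ae_tendsto hD0 hsolid hcl Q hd X.measurable <| by
      filter_upwards [ae_all_iff.2 hdX,
        ae_all_iff.2 fun n => (memLp_min_natCast Q hX0 n).coeFn_toLp] with ω h1 h2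
      simpa only [h1, h2] using tendsto_min_natCast (X ω)
    exact ⟨e, he, j_eq_iff.2 heX⟩
  intro n
  by_contra hn
  obtain ⟨d₀, hd₀⟩ := hD
  have hx0 : 0 ≤ (memLp_min_natCast Q hX0 n).toLp := by
    refine (Lp.coeFn_nonneg _).1 ?_
    filter_upwards [(memLp_min_natCast Q hX0 n).coeFn_toLp,
      ae_of_ae_qsMeasure Q (ae_nonneg hX0)] with ω h1 h2
    rw [h1]
    exact le_min h2 n.cast_nonneg
  have hzero : (0 : Lp ℝ 2 (Q.1 : Measure Ω)) ∈ l2Part Q D := by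
    refine ⟨0, hsolid.mem_of_le hd₀ le_rfl (hD0 hd₀), ?_⟩
    filter_upwards [ae_of_ae_qsMeasure Q (AEEqFun.coeFn_const Ω (0 : ℝ)), Lp.coeFn_zero ℝ 2 _]
      with ω h1 h2
    exact h1.trans h2.symm
  obtain ⟨Z, hZm, hZ0, ⟨m, hm, hZle⟩, hZS, hZX⟩ := exists_bounded_separating
    (convex_l2Part Q hconv) (isClosed_l2Part Q hD0 hsolid hcl) hzero
    (fun f hf => nonneg_of_mem_l2Part hD0 hf)
    (fun f hf g hg hgf => mem_l2Part_of_le hD0 hsolid hf hg hgf) hx0 hn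
  set W : L0 𝓟 := AEEqFun.mk Z hZm.aestronglyMeasurable with hW
  have hWZ : W =ᵐ[qsMeasure 𝓟] Z := AEEqFun.coeFn_mk _ _
  have hexp (Y : L0 𝓟) :
      expect Q (W * Y) = ∫⁻ ω, ENNReal.ofReal (Z ω * Y ω) ∂(Q.1 : Measure Ω) := by
    rw [expect_mul]
    refine lintegral_congr_ae ?_
    filter_upwards [ae_of_ae_qsMeasure Q hWZ] with ω h
    rw [h]
  have hWmem : W ∈ Linftyplus 𝓟 := by
    refine ⟨nonneg_of_ae (hWZ.mono fun ω h => h ▸ hZ0 ω), m, hm, AEEqFun.coeFn_le.1 ?_⟩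
    filter_upwards [AEEqFun.coeFn_abs W, hWZ,
      (AEEqFun.coeFn_const Ω m : _ =ᵐ[qsMeasure 𝓟] _)] with ω h1 h2 h3
    rw [h1, h2, h3, abs_of_nonneg (hZ0 ω)]
    exact hZle ω
  refine (hX W hWmem fun Y hY => ?_).not_gt ?_
  · -- `Z` is controlled on the square integrable part only; truncate `Y` and pass to the limit.
    rw [hexp]
    refine lintegral_mul_le_of_tendsto hZm (fun k => Y.measurable.min measurable_const)
      (.of_forall fun ω => tendsto_min_natCast (Y ω)) fun k => ?_
    have hmk : Measurable fun ω => min (Y ω) (k : ℝ) := Y.measurable.min measurable_const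
    have hk := memLp_min_natCast Q (hD0 hY) k
    rw [← lintegral_congr_ae (hk.coeFn_toLp.mono fun ω h => by
      exact congrArg (fun t => ENNReal.ofReal (Z ω * t)) h)]
    refine hZS _ ⟨AEEqFun.mk _ hmk.aestronglyMeasurable,
      hsolid.mem_of_le hY (nonneg_of_ae ?_) (AEEqFun.coeFn_le.1 ?_), ?_⟩
    · filter_upwards [AEEqFun.coeFn_mk _ hmk.aestronglyMeasurable, ae_nonneg (hD0 hY)]
        with ω h1 h2
      rw [h1]
      exact le_min h2 k.cast_nonneg
    · filter_upwards [AEEqFun.coeFn_mk _ hmk.aestronglyMeasurable] with ω h1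
      rw [h1]
      exact min_le_left _ _
    · filter_upwards [ae_of_ae_qsMeasure Q (AEEqFun.coeFn_mk _ hmk.aestronglyMeasurable),
        hk.coeFn_toLp] with ω h1 h2
      rw [h1, h2]
  · rw [hexp]
    refine hZX.trans_le (lintegral_mono_ae ?_)
    filter_upwards [(memLp_min_natCast Q hX0 n).coeFn_toLp] with ω h
    rw [h]
    exact ENNReal.ofReal_le_ofReal (mul_le_mul_of_nonneg_left (min_le_left _ _) (hZ0 ω))

/-! ### Minimality of the bipolar -/

/-- Minimality of the bipolar: the reduction set reduces `X ∈ D` to `j Q X ∈ j Q '' D` for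
`Q ∈ 𝓠`, which is the bipolar theorem under the single measure `Q`. -/
theorem bipolar_subset {𝓧 : Set (L0 𝓟)} (h𝓧 : L0plus 𝓟 ⊆ 𝓧) {𝓠 : Set (Pc 𝓟)}
    {C D : Set (L0 𝓟)} (hC : C.Nonempty) (hD0 : D ⊆ L0plus 𝓟) (hCD : C ⊆ D)
    (hD : IsBipolarClosedIn 𝓧 𝓠 D) : bipolar 𝓠 C ⊆ D := by
  intro X hX
  rw [hD.reductionSet.2]
  refine ⟨h𝓧 hX.1, Set.mem_iInter₂.2 fun Q hQ => ?_⟩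
  exact j_mem_image_of_forall_expect_le (hC.mono hCD) hD0 hD.convex hD.solid hD.seqOrderClosed hX.1
    fun Z hZ hZD => hX.2 (Q, Z) ⟨⟨hQ, hZ⟩, fun Y hY => hZD Y (hCD hY)⟩

theorem bipolar_characterization {𝓧 : Set (L0 𝓟)} (h𝓧 : L0plus 𝓟 ⊆ 𝓧) {𝓠 : Set (Pc 𝓟)}
    {C : Set (L0 𝓟)} (hC : C.Nonempty) (hCpos : C ⊆ L0plus 𝓟)
    (hclosed : IsBipolarClosedIn 𝓧 𝓠 (bipolar 𝓠 C)) :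
    IsBipolarClosedIn 𝓧 𝓠 (bipolar 𝓠 C) ∧
      C ⊆ bipolar 𝓠 C ∧
      (∀ D : Set (L0 𝓟), D ⊆ L0plus 𝓟 → C ⊆ D → IsBipolarClosedIn 𝓧 𝓠 D →
        bipolar 𝓠 C ⊆ D) ∧
      (C = bipolar 𝓠 C ↔ IsBipolarClosedIn 𝓧 𝓠 C) :=
  ⟨hclosed, subset_bipolar 𝓠 hCpos, fun _ hD0 hCD hD => bipolar_subset h𝓧 hC hD0 hCD hD,
    fun h => h.symm ▸ hclosed, fun h => (subset_bipolar 𝓠 hCpos).antisymm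
      (bipolar_subset h𝓧 hC hCpos subset_rfl h)⟩

end RobustBipolar

/-- The first part treats every non-empty `𝓠`, with reduction sets taken in the ambient set
`L⁰_{c+}` of the bipolar. The second part has reduction sets in all of `L⁰_c`, provided that `𝓠`
dominates `𝓟`: a non-empty subset of `L⁰_{c+}` has no such reduction set otherwise. -/
theorem mainTheorem1 {Ω : Type*} [MeasurableSpace Ω]
    (𝓟 : Set (ProbabilityMeasure Ω)) (h𝓟 : 𝓟.Nonempty)
    (C : Set (L0 𝓟)) (hC : C.Nonempty) (hCpos : C ⊆ L0plus 𝓟)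
    (𝓠 : Set (Pc 𝓟)) (h𝓠 : 𝓠.Nonempty) :
    (IsBipolarClosedIn (L0plus 𝓟) 𝓠 (bipolar 𝓠 C) ∧
      C ⊆ bipolar 𝓠 C ∧
      (∀ D : Set (L0 𝓟), D ⊆ L0plus 𝓟 → C ⊆ D → IsBipolarClosedIn (L0plus 𝓟) 𝓠 D →
        bipolar 𝓠 C ⊆ D) ∧
      (C = bipolar 𝓠 C ↔ IsBipolarClosedIn (L0plus 𝓟) 𝓠 C)) ∧
    (DominatedBy 𝓟 (Subtype.val '' 𝓠) →
      IsBipolarClosedIn Set.univ 𝓠 (bipolar 𝓠 C) ∧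
      C ⊆ bipolar 𝓠 C ∧
      (∀ D : Set (L0 𝓟), D ⊆ L0plus 𝓟 → C ⊆ D → IsBipolarClosedIn Set.univ 𝓠 D →
        bipolar 𝓠 C ⊆ D) ∧
      (C = bipolar 𝓠 C ↔ IsBipolarClosedIn Set.univ 𝓠 C)) := by
  refine ⟨bipolar_characterization subset_rfl hC hCpos
    (isBipolarClosedIn_bipolar h𝓠 C subset_rfl fun _ hX _ => hX), fun hdom =>
    bipolar_characterization (Set.subset_univ _) hC hCpos
      (isBipolarClosedIn_bipolar h𝓠 C (Set.subset_univ _) fun _ _ hX => ?_)⟩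
  exact nonneg_of_forall_j_mem hdom (fun _ h => h.1) hX
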